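/- A group $G$ has the \emph{Bergman property} (is \emph{Bergman}) if, whenever $W_0\subseteq W_1\subseteq W_2\subseteq\cdots$ is an increasing sequence of subsets of $G$ with $\bigcup_n W_n=G$, there are $n$ and $k$ such that $G=W_n^k$, where $W_n^k$ is the set of all products of $k$ elements of $W_n$. Let $S^1=\mathbb{R}/\mathbb{Z}$, and let $\mathcal{C}\subseteq S^1$ be any countable dense subset (for example, the image of $\mathbb{Q}$). Let $B$ be the ternary relation on $\mathcal{C}$ such that $B(x,y,z)$ holds if and only if $x,y,z$ are distinct and, going clockwise along $S^1$ from $x$ to $z$, one passes through $y$. Let $\mathrm{Aut}(\mathcal{C})$ be the group of all permutations $g$ of $\mathcal{C}$ that preserve $B$, i.e. $B(gx,gy,gz)\Leftrightarrow B(x,y,z)$ for all $x,y,z\in\mathcal{C}$. Let $\mathrm{Hom}(S^1)$ be the group of all homeomorphisms of $S^1$ onto itself, orientation preserving or not. Theorem. $\mathrm{Aut}(\mathcal{C})$ and $\mathrm{Hom}(S^1)$ are Bergman. -/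

import Mathlib

open scoped Pointwise

/-- A group `G` has the Bergman property if for every increasing sequence
`W 0 ⊆ W 1 ⊆ …` of subsets of `G` with union `G` there are `n` and `k` such that
`G = W n ^ k`, where `W n ^ k` is the set of all products of `k` elements of `W n`. -/
def IsBergman (G : Type*) [Group G] : Prop :=
  ∀ W : ℕ → Set G, Monotone W → ⋃ n, W n = Set.univ → ∃ n k : ℕ, W n ^ k = Set.univ

namespace CircleOrder

/-- `CWBetween x y z`: the points `x`, `y`, `z` of the circle `ℝ/ℤ` are distinct and going
clockwise along the circle from `x` to `z` one passes through `y`. Mathlib's strict circular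
order `sbtw` on `ℝ/ℤ` is the counterclockwise one (the direction of increasing reals), and
clockwise from `x` via `y` to `z` is counterclockwise from `z` via `y` to `x`. -/
def CWBetween (x y z : UnitAddCircle) : Prop :=
  sbtw z y x

/-- The automorphism group of the circular order on a set `C` of points of the circle:
all permutations of `C` that preserve the ternary relation `CWBetween`. -/
def aut (C : Set UnitAddCircle) : Subgroup (Equiv.Perm C) where
  carrier := {g | ∀ x y z : C, CWBetween (g x) (g y) (g z) ↔ CWBetween x y z}
  one_mem' := fun _ _ _ => Iff.rfl
  mul_mem' := fun {a b} ha hb x y z => (ha (b x) (b y) (b z)).trans (hb x y z)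
  inv_mem' := fun {a} ha x y z => by
    have h := ha (a⁻¹ x) (a⁻¹ y) (a⁻¹ z)
    simp only [← Equiv.Perm.mul_apply, mul_inv_cancel, Equiv.Perm.one_apply] at h
    exact h.symm

end CircleOrder

/-! A group is Bergman once every length function on it is bounded. Both groups act faithfully on
the projective line `OnePoint K`, with `K = ℝ` for the homeomorphisms and `K = ℚ` for a countable
dense set (Cantor's theorem). The image contains all order automorphisms of `K` and the map `x ↦ 1 /
(1 - x)`, and the stabilizer of `∞` acts on `K` by monotone or antitone bijections. Only these facts
are used.

A length is bounded on the order automorphisms supported in `(0, 1)`: each is a commutator with a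
fixed element, and a sequence of growing length could be packed into one automorphism, along
disjoint translates of an interval, from which it is recovered at linear cost
(`IsLength.bounded_of_displacement`). Conjugation by `x ↦ 1 / (1 - x)` gives the same for `(1, ∞)`
and `(-∞, 0)`, hence a bound on the order automorphisms fixing `0` and `1`. Release `1`, `0` and `∞`
in turn: each larger set is covered by boundedly short products of the smaller one with one fixed
element (`IsLength.bounded_of_cyclicPerm_mem`). -/

/-- A subadditive symmetric length function on a group. -/
structure IsLength {G : Type*} [Group G] (ℓ : G → ℕ) : Prop where
  mul_le : ∀ g h, ℓ (g * h) ≤ ℓ g + ℓ h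
  inv_le : ∀ g, ℓ g⁻¹ ≤ ℓ g

namespace IsLength

variable {G H : Type*} [Group G] [Group H] {ℓ : G → ℕ}

theorem comp (hℓ : IsLength ℓ) (φ : H →* G) : IsLength (ℓ ∘ φ) where
  mul_le g h := by simpa using hℓ.mul_le (φ g) (φ h)
  inv_le g := by simpa using hℓ.inv_le (φ g)

theorem pow_le (hℓ : IsLength ℓ) (g : G) (n : ℕ) : ℓ (g ^ n) ≤ ℓ 1 + n * ℓ g := by
  induction n with
  | zero => simp
  | succ n ih =>
    rw [pow_succ]
    have := hℓ.mul_le (g ^ n) g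
    linarith

theorem conj_le (hℓ : IsLength ℓ) (g h : G) : ℓ (g * h * g⁻¹) ≤ 2 * ℓ g + ℓ h := by
  have h1 := hℓ.mul_le (g * h) g⁻¹
  have h2 := hℓ.mul_le g h
  have h3 := hℓ.inv_le g
  omega

/-- A length which is bounded on a subset `S` and such that every element outside `S` is a product
`a * r * b` with `a, b ∈ S`, or the inverse of such a product, is bounded. -/
theorem bounded_of_double_coset (hℓ : IsLength ℓ) {S T : Set G} {r : G}
    (hS : ∃ B, ∀ g ∈ S, ℓ g ≤ B)
    (hT : ∀ g ∈ T, ∃ a ∈ S, ∃ b ∈ S, g = b ∨ g = a * r * b ∨ g⁻¹ = a * r * b) :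
    ∃ B, ∀ g ∈ T, ℓ g ≤ B := by
  obtain ⟨B, hB⟩ := hS
  refine ⟨2 * B + ℓ r, fun g hg => ?_⟩
  obtain ⟨a, ha, b, hb, h⟩ := hT g hg
  have h1 := hB a ha
  have h2 := hB b hb
  have h3 := hℓ.mul_le (a * r) b
  have h4 := hℓ.mul_le a r
  have h5 := hℓ.inv_le g⁻¹
  rw [inv_inv] at h5
  rcases h with h | h | h
  · subst h; omega
  · rw [h]; omega
  · rw [h] at h5; omega

end IsLength

/-- A group is Bergman as soon as all its length functions are bounded. -/
theorem isBergman_of_bounded {G : Type*} [Group G]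
    (h : ∀ ℓ : G → ℕ, IsLength ℓ → ∃ B, ∀ g, ℓ g ≤ B) : IsBergman G := by
  classical
  intro W hW hU
  have hex : ∀ g : G, ∃ n, g ∈ W n := fun g => by
    simpa using (Set.ext_iff.1 hU g).2 trivial
  obtain ⟨N, hN⟩ := hex 1
  let U : ℕ → Set G := fun n => W (N + n) ∩ (W (N + n))⁻¹
  have hU1 : ∀ n, (1 : G) ∈ U n := fun n => by
    have : (1 : G) ∈ W (N + n) := hW (Nat.le_add_right N n) hN
    exact ⟨this, by simpa using this⟩
  have hUm : Monotone U := fun m n hmn => by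
    have := hW (Nat.add_le_add_left hmn N)
    exact Set.inter_subset_inter this (Set.inv_subset_inv.2 this)
  have hUi : ∀ n, (U n)⁻¹ = U n := fun n => by
    simp only [U, Set.inter_inv, inv_inv, Set.inter_comm]
  -- The exponent doubles so that `V n * V n ⊆ V (n + 1)`. One plus the first index at which an
  -- element appears is then subadditive.
  let V : ℕ → Set G := fun n => U n ^ 2 ^ n
  have hVm : Monotone V := monotone_nat_of_le_succ fun n =>
    (Set.pow_subset_pow_left (hUm n.le_succ)).trans
      (Set.pow_right_monotone (hU1 _) (Nat.pow_le_pow_right two_pos n.le_succ))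
  have hVV : ∀ n, ∀ a ∈ V n, ∀ b ∈ V n, a * b ∈ V (n + 1) := fun n a ha b hb => by
    have : a * b ∈ U n ^ 2 ^ (n + 1) := by
      rw [pow_succ, mul_two, pow_add]
      exact Set.mul_mem_mul ha hb
    exact Set.pow_subset_pow_left (hUm n.le_succ) this
  have hVi : ∀ n, ∀ a ∈ V n, a⁻¹ ∈ V n := fun n a ha => by
    have : a⁻¹ ∈ (V n)⁻¹ := by simpa using ha
    simpa only [V, ← inv_pow, hUi] using this
  have hV : ∀ g, ∃ n, g ∈ V n := fun g => by
    obtain ⟨m, hm⟩ := hex g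
    obtain ⟨n, hn⟩ := hex g⁻¹
    have h1 : g ∈ U (m + n) := ⟨hW (by omega) hm, by
      simpa using hW (show n ≤ N + (m + n) by omega) hn⟩
    exact ⟨m + n, Set.subset_pow (hU1 _) (by positivity) h1⟩
  obtain ⟨B, hB⟩ := h (fun g => Nat.find (hV g) + 1)
    { mul_le := fun g k => by
        have h1 := hVm (le_max_left (Nat.find (hV g)) (Nat.find (hV k))) (Nat.find_spec (hV g))
        have h2 := hVm (le_max_right (Nat.find (hV g)) (Nat.find (hV k))) (Nat.find_spec (hV k))
        have := Nat.find_min' (hV (g * k)) (hVV _ _ h1 _ h2)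
        omega
      inv_le := fun g => by
        have := Nat.find_min' (hV g⁻¹) (hVi _ _ (Nat.find_spec (hV g)))
        omega }
  refine ⟨N + B, 2 ^ B, Set.eq_univ_of_forall fun g => ?_⟩
  have h1 : g ∈ V B := hVm (by have := hB g; omega) (Nat.find_spec (hV g))
  exact Set.pow_subset_pow_left Set.inter_subset_left h1

theorem IsBergman.of_mulEquiv {G H : Type*} [Group G] [Group H] (e : G ≃* H)
    (h : ∀ ℓ : G → ℕ, IsLength ℓ → ∃ B, ∀ g, ℓ g ≤ B) : IsBergman H :=
  isBergman_of_bounded fun ℓ hℓ => by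
    obtain ⟨B, hB⟩ := h _ (hℓ.comp e.toMonoidHom)
    exact ⟨B, fun g => by simpa using hB (e.symm g)⟩

/-! ### Gluing order automorphisms and the displacement argument. -/

section Glue

variable {L : Type*} [LinearOrder L]

/-- Automorphisms of a linear order preserving pairwise disjoint convex sets can be glued along
these sets, with the identity elsewhere. -/
theorem OrderIso.exists_glue {ι : Type*} (S : ι → Set L) (hS : ∀ i, (S i).OrdConnected)
    (hd : ∀ i j x, x ∈ S i → x ∈ S j → i = j) (f : ι → (L ≃o L))
    (hf : ∀ i x, f i x ∈ S i ↔ x ∈ S i) :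
    ∃ F : L ≃o L, (∀ i, ∀ x ∈ S i, F x = f i x) ∧ ∀ x, (∀ i, x ∉ S i) → F x = x := by
  classical
  let glue : (ι → (L ≃o L)) → L → L := fun f x =>
    if h : ∃ i, x ∈ S i then f h.choose x else x
  have glue_mem : ∀ f i x, x ∈ S i → glue f x = f i x := fun f i x hx => by
    have h : ∃ i, x ∈ S i := ⟨i, hx⟩
    simp only [glue, dif_pos h, hd _ _ _ h.choose_spec hx]
  have glue_not : ∀ f x, (∀ i, x ∉ S i) → glue f x = x := fun f x hx => by
    simp [glue, hx]
  have hf' : ∀ i x, (f i).symm x ∈ S i ↔ x ∈ S i := fun i x => by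
    rw [← hf, OrderIso.apply_symm_apply]
  have hmono : StrictMono (glue f) := by
    intro x y hxy
    by_contra! hle
    -- If the order of `x < y` were reversed, convexity would put one of the points or its image
    -- into the other's piece.
    by_cases hx : ∃ i, x ∈ S i
    · obtain ⟨i, hx⟩ := hx
      rw [glue_mem f i x hx] at hle
      have hfx := (hf i x).2 hx
      by_cases hy : ∃ j, y ∈ S j
      · obtain ⟨j, hy⟩ := hy
        rw [glue_mem f j y hy] at hle
        have hfy := (hf j y).2 hy
        have hij : i = j := by
          rcases le_total (f j y) x with h | h
          · exact hd _ _ _ hx ((hS j).out hfy hy ⟨h, hxy.le⟩)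
          · exact hd _ _ _ ((hS i).out hx hfx ⟨h, hle⟩) hfy
        subst hij
        exact absurd hxy (not_lt.2 ((f i).le_iff_le.1 hle))
      · push Not at hy
        rw [glue_not f y hy] at hle
        exact hy i ((hS i).out hx hfx ⟨hxy.le, hle⟩)
    · push Not at hx
      rw [glue_not f x hx] at hle
      by_cases hy : ∃ j, y ∈ S j
      · obtain ⟨j, hy⟩ := hy
        rw [glue_mem f j y hy] at hle
        exact hx j ((hS j).out ((hf j y).2 hy) hy ⟨hle, hxy.le⟩)
      · push Not at hy
        rw [glue_not f y hy] at hle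
        exact absurd hxy (not_lt.2 hle)
  have hinv : ∀ y, glue f (glue (fun i => (f i).symm) y) = y := fun y => by
    by_cases hy : ∃ j, y ∈ S j
    · obtain ⟨j, hy⟩ := hy
      rw [glue_mem (fun i => (f i).symm) j y hy, glue_mem f j _ ((hf' j y).2 hy), OrderIso.apply_symm_apply]
    · push Not at hy
      rw [glue_not (fun i => (f i).symm) y hy, glue_not f y hy]
  exact ⟨hmono.orderIsoOfSurjective _ fun y => ⟨_, hinv y⟩, fun i x => glue_mem f i x,
    fun x => glue_not f x⟩

theorem OrderIso.exists_glue_one (S : Set L) (hS : S.OrdConnected) (f : L ≃o L)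
    (hf : ∀ x, f x ∈ S ↔ x ∈ S) :
    ∃ F : L ≃o L, (∀ x ∈ S, F x = f x) ∧ ∀ x ∉ S, F x = x := by
  obtain ⟨F, h1, h2⟩ := OrderIso.exists_glue (fun _ : Unit => S) (fun _ => hS)
    (fun _ _ _ _ _ => rfl) (fun _ => f) (fun _ => hf)
  exact ⟨F, h1 (), fun x hx => h2 x fun _ => hx⟩

theorem OrderIso.mem_iff_of_support {f : L ≃o L} {S : Set L} (hf : ∀ x ∉ S, f x = x) (x : L) :
    f x ∈ S ↔ x ∈ S := by
  by_cases hx : x ∈ S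
  · simp only [hx, iff_true]
    by_contra h
    exact h ((f.injective (hf _ h)).symm ▸ hx)
  · rw [hf x hx]

theorem OrderIso.mem_pow_iff {f : L ≃o L} {S : Set L} (hf : ∀ x, f x ∈ S ↔ x ∈ S) (n : ℕ) (x : L) :
    (f ^ n) x ∈ S ↔ x ∈ S := by
  induction n with
  | zero => rfl
  | succ n ih => rw [pow_succ', RelIso.mul_apply, hf, ih]

/-- The translates `t ^ n` of `I` are pairwise disjoint: a common point of two of them would give a
point of `I` returning to `I` under a positive power of `t`. -/
theorem OrderIso.eq_of_mem_displaced {t : L ≃o L} {I : Set L}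
    (htI : ∀ n : ℕ, ∀ x ∈ I, (t ^ (n + 1)) x ∉ I) (m n : ℕ) (x : L)
    (hm : x ∈ {x | (t ^ m)⁻¹ x ∈ I}) (hn : x ∈ {x | (t ^ n)⁻¹ x ∈ I}) : m = n := by
  have key : ∀ m n : ℕ, m < n → (t ^ m)⁻¹ x ∈ I → (t ^ n)⁻¹ x ∈ I → False := by
    intro m n hmn hm hn
    obtain ⟨k, rfl⟩ := Nat.exists_eq_add_of_lt hmn
    apply htI k _ hn
    have h1 : t ^ (k + 1) * (t ^ (m + k + 1))⁻¹ = (t ^ m)⁻¹ := by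
      rw [mul_inv_eq_iff_eq_mul, eq_inv_mul_iff_mul_eq, ← pow_add, add_assoc]
    rwa [← RelIso.mul_apply, h1]
  rcases lt_trichotomy m n with h | h | h
  · exact (key _ _ h hm hn).elim
  · exact h
  · exact (key _ _ h hn hm).elim

/-- If `t` displaces the convex set `I` off itself inside `J`, then an automorphism supported
in `I` is a commutator of `t` with an automorphism supported in `J`. -/
theorem OrderIso.exists_commutator {I J : Set L} (hI : I.OrdConnected) (hIJ : I ⊆ J) {t : L ≃o L}
    (ht : ∀ x ∉ J, t x = x) (htI : ∀ n : ℕ, ∀ x ∈ I, (t ^ (n + 1)) x ∉ I) {h : L ≃o L}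
    (hh : ∀ x ∉ I, h x = x) :
    ∃ a : L ≃o L, (∀ x ∉ J, a x = x) ∧ h = a * t * a⁻¹ * t⁻¹ := by
  have hhI := OrderIso.mem_iff_of_support hh
  have htJ := OrderIso.mem_iff_of_support ht
  -- An infinite swindle: `a` carries a copy of `h` on each translate of `I`, `n ≥ 0`. Conjugating
  -- by `t` shifts the copies by one, so `a` and `t * a * t⁻¹` differ only by the copy at `n = 0`,
  -- which is `h`.
  obtain ⟨a, ha, ha'⟩ := OrderIso.exists_glue (fun n : ℕ => {x | (t ^ n)⁻¹ x ∈ I})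
    (fun n => hI.preimage_mono (t ^ n)⁻¹.monotone) (OrderIso.eq_of_mem_displaced htI)
    (fun n => t ^ n * h * (t ^ n)⁻¹) (fun n x => by
      simp only [Set.mem_ofPred_eq, RelIso.mul_apply, RelIso.inv_apply_self, hhI])
  have hS0 : ∀ x, (t ^ 0)⁻¹ x ∈ I ↔ x ∈ I := fun x => by simp
  have hSs : ∀ n x, (t ^ (n + 1))⁻¹ (t x) = (t ^ n)⁻¹ x := fun n x => by
    rw [← RelIso.mul_apply, pow_succ', mul_inv_rev, inv_mul_cancel_right]
  refine ⟨a, fun x hx => ha' x fun n hn => hx ?_, ?_⟩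
  · have := (OrderIso.mem_pow_iff htJ n _).2 (hIJ hn)
    rwa [RelIso.apply_inv_self] at this
  · rw [eq_mul_inv_iff_mul_eq, eq_mul_inv_iff_mul_eq]
    ext x
    simp only [RelIso.mul_apply]
    by_cases hx : ∃ n, (t ^ n)⁻¹ x ∈ I
    · obtain ⟨n, hn⟩ := hx
      have h1 : (t ^ (n + 1))⁻¹ (t x) ∈ I := by rwa [hSs]
      rw [ha n x hn, ha (n + 1) (t x) h1]
      simp only [RelIso.mul_apply, hSs]
      rw [hh, pow_succ']
      · rfl
      · rw [← RelIso.mul_apply, ← pow_succ']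
        exact htI n _ ((hhI _).2 hn)
    · push Not at hx
      rw [ha' x hx]
      by_cases h0 : t x ∈ I
      · rw [ha 0 (t x) ((hS0 _).2 h0)]
        simp
      · rw [hh _ h0, ha']
        rintro (_ | n) hn
        · exact h0 ((hS0 _).1 hn)
        · exact hx n (by simpa only [Set.mem_ofPred_eq, hSs] using hn)

/-- If `ℓ (h n) > n ^ 2`, write `h n` as a commutator of `t` with some `a n` supported in `J`, and
glue the conjugates of all `a n` along the disjoint translates `s ^ n` of `J` into one `F`.
Conjugating `F` back by `s ^ n` recovers `a n` on `J`, so `ℓ (h n)` grows at most linearly in `n`.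
-/
theorem IsLength.bounded_of_displacement {ℓ : (L ≃o L) → ℕ} (hℓ : IsLength ℓ) {I J : Set L}
    (hI : I.OrdConnected) (hJ : J.OrdConnected) (hIJ : I ⊆ J) {s t : L ≃o L}
    (ht : ∀ x ∉ J, t x = x) (htI : ∀ n : ℕ, ∀ x ∈ I, (t ^ (n + 1)) x ∉ I)
    (hs : ∀ n : ℕ, ∀ x ∈ J, (s ^ (n + 1)) x ∉ J) :
    ∃ B, ∀ h : L ≃o L, (∀ x ∉ I, h x = x) → ℓ h ≤ B := by
  by_contra! hcon
  choose h hh hlt using fun n : ℕ => hcon (n * n)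
  choose a ha hha using fun n => OrderIso.exists_commutator hI hIJ ht htI (hh n)
  have haJ := fun n => OrderIso.mem_iff_of_support (ha n)
  have htJ := OrderIso.mem_iff_of_support ht
  obtain ⟨F, hF, -⟩ := OrderIso.exists_glue (fun n : ℕ => {x | (s ^ n)⁻¹ x ∈ J})
    (fun n => hJ.preimage_mono (s ^ n)⁻¹.monotone) (OrderIso.eq_of_mem_displaced hs)
    (fun n => s ^ n * a n * (s ^ n)⁻¹) (fun n x => by
      simp only [Set.mem_ofPred_eq, RelIso.mul_apply, RelIso.inv_apply_self, haJ])
  -- The conjugate of `F` may differ from `a n` off `J`, but it preserves the complement of `J`,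
  -- where `t` is the identity, so the commutator does not see this.
  have key : ∀ n, h n = ((s ^ n)⁻¹ * F * s ^ n) * t * ((s ^ n)⁻¹ * F * s ^ n)⁻¹ * t⁻¹ := by
    intro n
    set g := (s ^ n)⁻¹ * F * s ^ n with hg
    have hgJ : ∀ x ∈ J, g x = a n x := fun x hx => by
      have := hF n ((s ^ n) x) (by simpa using hx)
      simp [hg, this]
    have hgJ' : ∀ x, g x ∈ J → x ∈ J := fun x hx => by
      have h1 : (a n)⁻¹ (g x) ∈ J := by
        rw [← haJ n]
        simpa using hx
      have h2 : g ((a n)⁻¹ (g x)) = g x := by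
        rw [hgJ _ h1, RelIso.apply_inv_self]
      rwa [g.injective h2] at h1
    rw [eq_mul_inv_iff_mul_eq, eq_mul_inv_iff_mul_eq]
    ext x
    by_cases hx : x ∈ J
    · rw [hha n]
      simp only [RelIso.mul_apply]
      rw [hgJ _ ((htJ x).2 hx), hgJ x hx]
      simp
    · simp only [RelIso.mul_apply]
      rw [ht x hx, ht _ fun h1 => hx (hgJ' x h1), hh n _ fun h1 => hx (hgJ' x (hIJ h1))]
  have bound : ∀ n, n * n < 2 * ℓ F + 4 * (ℓ 1 + n * ℓ s) + 2 * ℓ t := by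
    intro n
    have h0 := hlt n
    rw [key n] at h0
    set g := (s ^ n)⁻¹ * F * s ^ n with hg
    have h1 := hℓ.mul_le (g * t * g⁻¹) t⁻¹
    have h2 := hℓ.conj_le g t
    have h3 := hℓ.inv_le t
    have h4 := hℓ.mul_le ((s ^ n)⁻¹ * F) (s ^ n)
    rw [← hg] at h4
    have h5 := hℓ.mul_le (s ^ n)⁻¹ F
    have h6 := hℓ.inv_le (s ^ n)
    have h7 := hℓ.pow_le s n
    omega
  have := bound (2 * ℓ F + 4 * ℓ 1 + 2 * ℓ t + 4 * ℓ s + 1)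
  nlinarith

end Glue

/-! ### Permutations of the projective line. -/

section ProjectiveLine

variable {L : Type*} [LinearOrder L]

/-- The map induced by an order automorphism on the projective line. -/
def OnePoint.permOfOrderIso : (L ≃o L) →* Equiv.Perm (OnePoint L) where
  toFun f :=
    { toFun := OnePoint.map f
      invFun := OnePoint.map f.symm
      left_inv := fun x => by induction x <;> simp
      right_inv := fun x => by induction x <;> simp }
  map_one' := by ext x; induction x <;> simp
  map_mul' f g := by ext x; induction x <;> simp

@[simp]
theorem OnePoint.permOfOrderIso_coe (f : L ≃o L) (x : L) :
    OnePoint.permOfOrderIso f (x : OnePoint L) = (f x : L) := rfl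

@[simp]
theorem OnePoint.permOfOrderIso_infty (f : L ≃o L) :
    OnePoint.permOfOrderIso f OnePoint.infty = OnePoint.infty := rfl

variable {K : Type*} [Field K]

open Classical in
/-- The projective map `x ↦ 1 / (1 - x)`, which permutes `0`, `1` and `∞` cyclically. -/
noncomputable def OnePoint.cyclicPerm : Equiv.Perm (OnePoint K) where
  toFun x := x.elim ((0 : K) : OnePoint K) fun x => if x = 1 then OnePoint.infty else ((1 - x)⁻¹ : K)
  invFun x := x.elim ((1 : K) : OnePoint K) fun x => if x = 0 then OnePoint.infty else (1 - x⁻¹ : K)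
  left_inv x := by
    induction x with
    | infty => simp
    | coe x =>
      by_cases h : x = 1
      · simp [h]
      · have : 1 - x ≠ 0 := sub_ne_zero.2 (Ne.symm h)
        simp [h, this]
  right_inv x := by
    induction x with
    | infty => simp
    | coe x =>
      by_cases h : x = 0
      · simp [h]
      · simp [h]

theorem OnePoint.cyclicPerm_infty : OnePoint.cyclicPerm (OnePoint.infty : OnePoint K) = (0 : K) := by
  simp [OnePoint.cyclicPerm]

theorem OnePoint.cyclicPerm_one : OnePoint.cyclicPerm ((1 : K) : OnePoint K) = OnePoint.infty := by
  simp [OnePoint.cyclicPerm]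

theorem OnePoint.cyclicPerm_coe {x : K} (hx : x ≠ 1) :
    OnePoint.cyclicPerm (x : OnePoint K) = ((1 - x)⁻¹ : K) := by
  simp [OnePoint.cyclicPerm, hx]

end ProjectiveLine

/-! ### Bounding lengths over an ordered field. -/

section OrderedField

variable {K : Type*} [Field K] [LinearOrder K] [IsStrictOrderedRing K]

theorem OrderIso.exists_contraction :
    ∃ t : K ≃o K, (∀ x ∉ Set.Ioo (-1 : K) 3, t x = x) ∧
      ∀ n : ℕ, ∀ x ∈ Set.Ioo (0 : K) 1, (t ^ (n + 1)) x ∉ Set.Ioo (0 : K) 1 := by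
  -- Piecewise linear: `[-1, 1]` goes to `[-1, 0]` with slope `1/2`, `[1, 3]` to `[0, 3]` with slope
  -- `3/2`, and other points are fixed. Since `f 1 = 0` and `f y ≤ y`, points of `(0, 1)` drop below
  -- `0` and stay there.
  let f : K → K := fun y => min y (max ((y - 1) / 2) ((3 * y - 3) / 2))
  let g : K → K := fun z => max z (min (2 * z + 1) ((2 * z + 3) / 3))
  have hf : StrictMono f := fun x y hxy => by
    refine min_lt_min hxy (max_lt_max ?_ ?_) <;> linarith
  have hfg : Function.RightInverse g f := fun z => by
    simp only [f, g]
    rcases le_total (2 * z + 1) ((2 * z + 3) / 3) with h1 | h1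
    · rw [min_eq_left h1]
      rcases le_total z (2 * z + 1) with h2 | h2
      · rw [max_eq_right h2, max_eq_left (by linarith), min_eq_right (by linarith)]
        ring
      · rw [max_eq_left h2, min_eq_left (le_max_of_le_left (by linarith))]
    · rw [min_eq_right h1]
      rcases le_total z ((2 * z + 3) / 3) with h2 | h2
      · rw [max_eq_right h2, max_eq_right (by linarith), min_eq_right (by linarith)]
        ring
      · rw [max_eq_left h2, min_eq_left (le_max_of_le_right (by linarith))]
  let t := hf.orderIsoOfRightInverse f g hfg
  have ht : ∀ x, t x = min x (max ((x - 1) / 2) ((3 * x - 3) / 2)) := fun _ => rfl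
  refine ⟨t, fun x hx => ?_, fun n x hx hx' => ?_⟩
  · rw [ht, min_eq_left]
    by_contra! h
    exact hx ⟨by linarith [(max_lt_iff.1 h).1], by linarith [(max_lt_iff.1 h).2]⟩
  · have key : (t ^ (n + 1)) x ≤ 0 := by
      clear hx'
      induction n with
      | zero =>
        rw [zero_add, pow_one, ht]
        exact min_le_of_right_le (max_le (by linarith [hx.2]) (by linarith [hx.2]))
      | succ n ih =>
        rw [pow_succ', RelIso.mul_apply, ht]
        exact min_le_of_left_le ih
    exact absurd hx'.1 (not_lt.2 key)

theorem IsLength.bounded_of_support_Ioo {ℓ : (K ≃o K) → ℕ} (hℓ : IsLength ℓ) :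
    ∃ B, ∀ h : K ≃o K, (∀ x ∉ Set.Ioo (0 : K) 1, h x = x) → ℓ h ≤ B := by
  obtain ⟨t, ht, htI⟩ := OrderIso.exists_contraction (K := K)
  -- Translation by `4`, the length of `(-1, 3)`, displaces that interval.
  refine hℓ.bounded_of_displacement Set.ordConnected_Ioo Set.ordConnected_Ioo
    (Set.Ioo_subset_Ioo (by norm_num) (by norm_num)) ht htI (s := OrderIso.addRight 4)
    fun n x hx hx' => ?_
  have key : x + 4 ≤ (OrderIso.addRight (4 : K) ^ (n + 1)) x := by
    clear hx'
    induction n with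
    | zero => simp
    | succ n ih =>
      rw [pow_succ', RelIso.mul_apply, OrderIso.addRight_apply]
      linarith
  linarith [hx.1, hx'.2]

/-- Dilate about `a` on the right of `a` only. This adjusts the image of one point while keeping the
points already fixed to its left. -/
theorem OrderIso.exists_half_affine {a b c : K} (hac : a < c) (hab : a < b) :
    ∃ f : K ≃o K, (∀ x ≤ a, f x = x) ∧ f b = c := by
  have hm : 0 < (c - a) / (b - a) := div_pos (sub_pos.2 hac) (sub_pos.2 hab)
  let g : K ≃o K := ((OrderIso.addRight (-a)).trans (OrderIso.mulLeft₀ _ hm)).trans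
    (OrderIso.addRight a)
  have hg : ∀ x, g x = (c - a) / (b - a) * (x + -a) + a := fun _ => rfl
  obtain ⟨f, h1, h2⟩ := OrderIso.exists_glue_one (Set.Ioi a) Set.ordConnected_Ioi g fun x => by
    simp only [Set.mem_Ioi, hg, lt_add_iff_pos_left, mul_pos_iff_of_pos_left hm]
    rw [← sub_eq_add_neg, sub_pos]
  refine ⟨f, fun x hx => h2 x (not_lt.2 hx), ?_⟩
  rw [h1 b hab, hg, ← sub_eq_add_neg, div_mul_cancel₀ _ (sub_pos.2 hab).ne', sub_add_cancel]

namespace IsLength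

variable {Γ : Subgroup (Equiv.Perm (OnePoint K))} {ℓ : Γ → ℕ}

open OnePoint

/-- If `w ∈ Γ` maps only points of `(0, 1)` into `S`, then a length on `Γ` is bounded on the order
automorphisms supported in `S`. -/
theorem bounded_of_support_conj (hℓ : IsLength ℓ) (hΓ : ∀ f : K ≃o K, permOfOrderIso f ∈ Γ)
    (hΓ' : ∀ g ∈ Γ, g ∞ = ∞ → ∃ f : K ≃o K,
      (∀ x : K, g x = (f x : K)) ∨ ∀ x : K, g x = (-f x : K))
    {w : Equiv.Perm (OnePoint K)} (hw : w ∈ Γ) (S : Set K)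
    (hinf : ∀ x ∈ S, w ∞ ≠ x) (hwS : ∀ y ∉ Set.Ioo (0 : K) 1, ∀ x ∈ S, w y ≠ x) :
    ∃ B, ∀ f : K ≃o K, (∀ x ∉ S, f x = x) → ℓ ⟨permOfOrderIso f, hΓ f⟩ ≤ B := by
  let φ : (K ≃o K) →* Γ := permOfOrderIso.codRestrict Γ hΓ
  obtain ⟨B, hB⟩ := (hℓ.comp φ).bounded_of_support_Ioo
  refine ⟨2 * ℓ ⟨w, hw⟩ + B, fun f hf => ?_⟩
  have hfix : ∀ z : OnePoint K, (∀ x ∈ S, z ≠ x) → permOfOrderIso f z = z := fun z hz => by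
    induction z with
    | infty => rfl
    | coe z => rw [permOfOrderIso_coe, hf z fun h => hz z h rfl]
  let g : Γ := ⟨w, hw⟩⁻¹ * φ f * ⟨w, hw⟩
  have hg : ∀ z, (g : Equiv.Perm (OnePoint K)) z = w⁻¹ (permOfOrderIso f (w z)) := fun _ => rfl
  have hg1 : ∀ z, (∀ x ∈ S, w z ≠ x) → (g : Equiv.Perm (OnePoint K)) z = z := fun z hz => by
    rw [hg, hfix _ hz, Equiv.Perm.inv_eq_iff_eq]
  obtain ⟨k, hk⟩ := hΓ' g g.2 (hg1 _ hinf)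
  have hg2 : ∀ y ∉ Set.Ioo (0 : K) 1, (g : Equiv.Perm (OnePoint K)) y = y :=
    fun y hy => hg1 y (hwS y hy)
  -- The antitone alternative is impossible, since `g` fixes both `0` and `1`.
  replace hk : ∀ x : K, (g : Equiv.Perm (OnePoint K)) x = (k x : K) := by
    refine hk.resolve_right fun hk => ?_
    have h0 := (hk 0).symm.trans (hg2 0 (by simp))
    have h1 := (hk 1).symm.trans (hg2 1 (by simp))
    rw [OnePoint.coe_eq_coe] at h0 h1
    have := k.strictMono (zero_lt_one' K)
    linarith
  have hgk : g = φ k := by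
    ext z
    induction z with
    | infty => exact hg1 _ hinf
    | coe z => exact hk z
  have h1 := hB k fun x hx => by
    have := (hk x).symm.trans (hg2 x hx)
    rwa [OnePoint.coe_eq_coe] at this
  have h2 : φ f = ⟨w, hw⟩ * φ k * ⟨w, hw⟩⁻¹ := by
    rw [← hgk]
    simp only [g]
    group
  have h3 := hℓ.conj_le ⟨w, hw⟩ (φ k)
  rw [← h2] at h3
  simp only [Function.comp_apply] at h1
  exact h3.trans (by omega)

theorem bounded_of_cyclicPerm_mem (hℓ : IsLength ℓ) (hΓ : ∀ f : K ≃o K, permOfOrderIso f ∈ Γ)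
    (hrot : cyclicPerm ∈ Γ)
    (hΓ' : ∀ g ∈ Γ, g ∞ = ∞ → ∃ f : K ≃o K,
      (∀ x : K, g x = (f x : K)) ∨ ∀ x : K, g x = (-f x : K)) :
    ∃ B, ∀ g, ℓ g ≤ B := by
  let φ : (K ≃o K) →* Γ := permOfOrderIso.codRestrict Γ hΓ
  have hφ := hℓ.comp φ
  -- order automorphisms supported in one of the three intervals cut out by `0` and `1`
  obtain ⟨B₁, h₁⟩ := hφ.bounded_of_support_Ioo
  obtain ⟨B₂, h₂⟩ := hℓ.bounded_of_support_conj hΓ hΓ' hrot (Set.Ioi 1)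
    (fun x hx => by
      rw [cyclicPerm_infty, Ne, OnePoint.coe_eq_coe]
      exact (zero_lt_one.trans hx).ne)
    (fun y hy x hx => by
      by_cases h : y = 1
      · rw [h, cyclicPerm_one]
        exact infty_ne_coe x
      · rw [cyclicPerm_coe h, Ne, OnePoint.coe_eq_coe]
        rintro rfl
        rw [Set.mem_Ioi, one_lt_inv_iff₀] at hx
        exact hy ⟨by linarith [hx.2], by linarith [hx.1]⟩)
  obtain ⟨B₃, h₃⟩ := hℓ.bounded_of_support_conj hΓ hΓ' (Γ.inv_mem hrot) (Set.Iio 0)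
    (fun x hx => by
      rw [Ne, Equiv.Perm.inv_eq_iff_eq, cyclicPerm_coe (hx.trans zero_lt_one).ne]
      exact infty_ne_coe _)
    (fun y hy x hx => by
      have hx' : 0 < 1 - x := by linarith [Set.mem_Iio.1 hx]
      rw [Ne, Equiv.Perm.inv_eq_iff_eq, cyclicPerm_coe (hx.trans zero_lt_one).ne,
        OnePoint.coe_eq_coe]
      rintro rfl
      exact hy ⟨inv_pos.2 hx', inv_lt_one_of_one_lt₀ (by linarith [Set.mem_Iio.1 hx])⟩)
  -- order automorphisms fixing `0` and `1`
  have h₄ : ∃ B, ∀ f ∈ {f : K ≃o K | f 0 = 0 ∧ f 1 = 1}, (ℓ ∘ φ) f ≤ B := by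
    refine ⟨B₁ + B₂ + B₃, fun f ⟨hf0, hf1⟩ => ?_⟩
    have lt0 : ∀ x, f x < 0 ↔ x < 0 := fun x => by simpa [hf0] using f.lt_iff_lt (x := x) (y := 0)
    have lt1 : ∀ x, 1 < f x ↔ 1 < x := fun x => by simpa [hf1] using f.lt_iff_lt (x := 1) (y := x)
    have gt0 : ∀ x, 0 < f x ↔ 0 < x := fun x => by simpa [hf0] using f.lt_iff_lt (x := 0) (y := x)
    have gt1 : ∀ x, f x < 1 ↔ x < 1 := fun x => by simpa [hf1] using f.lt_iff_lt (x := x) (y := 1)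
    obtain ⟨a, ha, ha'⟩ := OrderIso.exists_glue_one (Set.Ioo (0 : K) 1) Set.ordConnected_Ioo f
      fun x => by simp [gt0, gt1]
    obtain ⟨b, hb, hb'⟩ := OrderIso.exists_glue_one (Set.Ioi (1 : K)) Set.ordConnected_Ioi f
      fun x => by simp [lt1]
    obtain ⟨c, hc, hc'⟩ := OrderIso.exists_glue_one (Set.Iio (0 : K)) Set.ordConnected_Iio f
      fun x => by simp [lt0]
    simp only [Set.mem_Ioo, Set.mem_Ioi, Set.mem_Iio] at *
    have hfabc : f = a * b * c := by
      ext x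
      simp only [RelIso.mul_apply]
      rcases lt_or_ge x 0 with h | h
      · have := (lt0 x).2 h
        rw [hc x h, hb' _ (by linarith), ha' _ fun h => by linarith [h.1]]
      · rw [hc' x (by linarith)]
        rcases lt_or_ge 1 x with h1 | h1
        · have := (lt1 x).2 h1
          rw [hb x h1, ha' _ fun h => by linarith [h.2]]
        · rw [hb' x (by linarith)]
          by_cases h2 : 0 < x ∧ x < 1
          · rw [ha x h2]
          · rw [ha' x h2]
            rcases h.eq_or_lt with h | h
            · rw [← h, hf0]
            · rw [show x = 1 by grind, hf1]
    have e1 : (ℓ ∘ φ) a ≤ B₁ := h₁ a ha'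
    have e2 : (ℓ ∘ φ) b ≤ B₂ := h₂ b hb'
    have e3 : (ℓ ∘ φ) c ≤ B₃ := h₃ c hc'
    have e4 := hφ.mul_le (a * b) c
    have e5 := hφ.mul_le a b
    rw [hfabc]
    omega
  -- order automorphisms fixing `0`
  have h₅ : ∃ B, ∀ f ∈ {f : K ≃o K | f 0 = 0}, (ℓ ∘ φ) f ≤ B := by
    -- If `f 1 > 1`, an `a` fixing `0` and `1` takes `2 = r 1` to `f 1`, and `(a * r)⁻¹ * f` fixes
    -- `0` and `1`. If `f 1 < 1`, use `f⁻¹`.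
    obtain ⟨r, hr, hr'⟩ := OrderIso.exists_half_affine (a := (0 : K)) (b := 1) (c := 2)
      (by norm_num) (by norm_num)
    have key : ∀ f : K ≃o K, f 0 = 0 → 1 < f 1 →
        ∃ a ∈ {f : K ≃o K | f 0 = 0 ∧ f 1 = 1}, ∃ b ∈ {f : K ≃o K | f 0 = 0 ∧ f 1 = 1},
          f = a * r * b := fun f hf hf1 => by
      obtain ⟨a, ha, ha'⟩ := OrderIso.exists_half_affine (a := (1 : K)) (b := 2) hf1 (by norm_num)
      have har : (a * r) 1 = f 1 := by simp [hr', ha']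
      have har' : (a * r) 0 = f 0 := by simp [hr, ha, hf]
      refine ⟨a, ⟨ha 0 zero_le_one, ha 1 le_rfl⟩, (a * r)⁻¹ * f, ⟨?_, ?_⟩, by group⟩
      · rw [RelIso.mul_apply, ← har', RelIso.inv_apply_self]
      · rw [RelIso.mul_apply, ← har, RelIso.inv_apply_self]
    refine hφ.bounded_of_double_coset (r := r) h₄ fun f hf => ?_
    rcases lt_trichotomy (f 1) 1 with h | h | h
    · have h0 : f⁻¹ 0 = 0 := by
        nth_rw 1 [← show f 0 = 0 from hf]
        exact RelIso.inv_apply_self f 0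
      have h1 : 1 < f⁻¹ 1 := by
        rw [← f.lt_iff_lt, RelIso.apply_inv_self]
        exact h
      obtain ⟨a, ha, b, hb, h⟩ := key f⁻¹ h0 h1
      exact ⟨a, ha, b, hb, .inr (.inr h)⟩
    · exact ⟨f, ⟨hf, h⟩, f, ⟨hf, h⟩, .inl rfl⟩
    · obtain ⟨a, ha, b, hb, h⟩ := key f hf h
      exact ⟨a, ha, b, hb, .inr (.inl h)⟩
  have h₆ : ∃ B, ∀ f ∈ (Set.univ : Set (K ≃o K)), (ℓ ∘ φ) f ≤ B := by
    have key : ∀ f : K ≃o K, 0 < f 0 →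
        ∃ a ∈ {f : K ≃o K | f 0 = 0}, ∃ b ∈ {f : K ≃o K | f 0 = 0},
          f = a * OrderIso.addRight 1 * b := fun f hf => by
      obtain ⟨a, ha, ha'⟩ := OrderIso.exists_half_affine (a := (0 : K)) (b := 1) hf zero_lt_one
      have har : (a * OrderIso.addRight (1 : K) : K ≃o K) 0 = f 0 := by simp [ha']
      refine ⟨a, ha 0 le_rfl, (a * OrderIso.addRight 1)⁻¹ * f, ?_, by group⟩
      rw [Set.mem_ofPred_eq, RelIso.mul_apply, ← har, RelIso.inv_apply_self]
    refine hφ.bounded_of_double_coset (r := OrderIso.addRight 1) h₅ fun f _ => ?_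
    rcases lt_trichotomy (f 0) 0 with h | h | h
    · have h1 : 0 < f⁻¹ 0 := by
        rw [← f.lt_iff_lt, RelIso.apply_inv_self]
        exact h
      obtain ⟨a, ha, b, hb, h⟩ := key f⁻¹ h1
      exact ⟨a, ha, b, hb, .inr (.inr h)⟩
    · exact ⟨f, h, f, h, .inl rfl⟩
    · obtain ⟨a, ha, b, hb, h⟩ := key f h
      exact ⟨a, ha, b, hb, .inr (.inl h)⟩
  -- the stabilizer of `∞`
  have h₇ : ∃ B, ∀ g ∈ {g : Γ | (g : Equiv.Perm (OnePoint K)) ∞ = ∞}, ℓ g ≤ B := by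
    obtain ⟨B, hB⟩ := h₆
    -- As `Γ` contains all order automorphisms, one antitone element in the stabilizer puts `x ↦ -x`
    -- into `Γ`. So the order automorphisms are either the whole stabilizer or, up to this one
    -- factor, all of it.
    by_cases hneg : ∃ n : Γ, (n : Equiv.Perm (OnePoint K)) ∞ = ∞ ∧
        ∀ x : K, (n : Equiv.Perm (OnePoint K)) x = (-x : K)
    · obtain ⟨n, hn, hn'⟩ := hneg
      refine ⟨ℓ n + B, fun g hg => ?_⟩
      obtain ⟨f, hf | hf⟩ := hΓ' g g.2 hg
      · have : g = φ f := by
          ext z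
          induction z with
          | infty => exact hg
          | coe z => exact hf z
        have h := hB f trivial
        rw [this]
        simp only [Function.comp_apply] at h
        omega
      · have : g = n * φ f := by
          ext z
          induction z with
          | infty => exact hg.trans hn.symm
          | coe z => exact (hf z).trans (hn' _).symm
        have h := hB f trivial
        have h' := hℓ.mul_le n (φ f)
        rw [this]
        simp only [Function.comp_apply] at h
        omega
    · refine ⟨B, fun g hg => ?_⟩
      obtain ⟨f, hf | hf⟩ := hΓ' g g.2 hg
      · have : g = φ f := by
          ext z
          induction z with
          | infty => exact hg
          | coe z => exact hf z
        rw [this]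
        exact hB f trivial
      · refine (hneg ⟨g * φ f⁻¹, ?_, fun x => ?_⟩).elim
        · exact hg
        · refine (hf (f⁻¹ x)).trans ?_
          rw [RelIso.apply_inv_self]
  -- `cyclicPerm` sends `∞` to `0`, and a translation then sends `0` to any finite value of `g ∞`.
  obtain ⟨B, hB⟩ := hℓ.bounded_of_double_coset (r := ⟨cyclicPerm, hrot⟩) (T := Set.univ) h₇ fun g _ => by
    cases hg : (g : Equiv.Perm (OnePoint K)) ∞ with
    | infty => exact ⟨g, hg, g, hg, .inl rfl⟩
    | coe x =>
      let a : Γ := φ (OrderIso.addRight x)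
      have har : ((a * ⟨cyclicPerm, hrot⟩ : Γ) : Equiv.Perm (OnePoint K)) ∞ =
          (g : Equiv.Perm (OnePoint K)) ∞ := by
        rw [Subgroup.coe_mul, Equiv.Perm.mul_apply, cyclicPerm_infty, hg]
        change ((OrderIso.addRight x 0 : K) : OnePoint K) = x
        simp
      refine ⟨a, rfl, (a * ⟨cyclicPerm, hrot⟩)⁻¹ * g, ?_, .inr (.inl (by group))⟩
      rw [Set.mem_ofPred_eq, Subgroup.coe_mul, Equiv.Perm.mul_apply, ← har, Subgroup.coe_inv,
        Equiv.Perm.inv_eq_iff_eq]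
  exact ⟨B, fun g => hB g trivial⟩

end IsLength

end OrderedField

open OnePoint in
theorem isBergman_of_injective_perm {K G : Type*} [Field K] [LinearOrder K] [IsStrictOrderedRing K]
    [Group G] (j : G →* Equiv.Perm (OnePoint K)) (hj : Function.Injective j)
    (hext : ∀ f : K ≃o K, permOfOrderIso f ∈ j.range) (hrot : cyclicPerm ∈ j.range)
    (hstab : ∀ g, j g ∞ = ∞ → ∃ f : K ≃o K,
      (∀ x : K, j g x = (f x : K)) ∨ ∀ x : K, j g x = (-f x : K)) : IsBergman G := by
  refine IsBergman.of_mulEquiv (MonoidHom.ofInjective hj).symm fun ℓ hℓ =>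
    hℓ.bounded_of_cyclicPerm_mem hext hrot ?_
  rintro _ ⟨g, rfl⟩ hg
  exact hstab g hg

/-! ### Homeomorphisms of the circle. -/

section Homeomorph

open OnePoint Filter Topology

theorem OnePoint.continuous_cyclicPerm :
    Continuous (cyclicPerm : Equiv.Perm (OnePoint ℝ)) := by
  have hcob : coclosedCompact ℝ = Bornology.cobounded ℝ := by
    rw [coclosedCompact_eq_cocompact, Metric.cobounded_eq_cocompact]
  have hcoe : Continuous fun x : ℝ => (x : OnePoint ℝ) := continuous_coe
  rw [continuous_iff_continuousAt]
  intro z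
  induction z with
  | infty =>
    rw [continuousAt_infty', cyclicPerm_infty, hcob]
    have h1 : Tendsto (fun x : ℝ => 1 - x) (Bornology.cobounded ℝ) (Bornology.cobounded ℝ) :=
      tendsto_const_sub_cobounded 1
    refine Tendsto.congr' ?_ ((hcoe.tendsto 0).comp (tendsto_inv₀_cobounded.comp h1))
    filter_upwards [Bornology.isBounded_def.1 (Bornology.isBounded_singleton (x := (1 : ℝ)))] with x hx
    exact (cyclicPerm_coe hx).symm
  | coe x =>
    rw [continuousAt_coe]
    by_cases hx : x = 1
    · subst hx
      rw [continuousAt_iff_punctured_nhds]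
      have h1 : Tendsto (fun x : ℝ => 1 - x) (𝓝[≠] 1) (𝓝[≠] 0) := by
        refine tendsto_nhdsWithin_of_tendsto_nhds_of_eventually_within _ ?_ ?_
        · refine Tendsto.mono_left ?_ nhdsWithin_le_nhds
          exact Continuous.tendsto' (by fun_prop) _ _ (by simp)
        · filter_upwards [self_mem_nhdsWithin] with x hx
          exact sub_ne_zero.2 (Ne.symm hx)
      have h2 := tendsto_inv₀_nhdsNE_zero.comp h1
      rw [← hcob] at h2
      rw [Function.comp_apply, cyclicPerm_one]
      refine Tendsto.congr' ?_ (tendsto_coe_infty.comp h2)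
      filter_upwards [self_mem_nhdsWithin] with x hx
      exact (cyclicPerm_coe hx).symm
    · have h1 : ContinuousAt (fun x : ℝ => (((1 - x)⁻¹ : ℝ) : OnePoint ℝ)) x :=
        hcoe.continuousAt.comp
          ((continuousAt_const.sub continuousAt_id).inv₀ (sub_ne_zero.2 (Ne.symm hx)))
      refine h1.congr ?_
      filter_upwards [isOpen_ne.mem_nhds hx] with y hy
      exact (cyclicPerm_coe hy).symm

theorem OnePoint.nonempty_homeomorph_unitAddCircle : Nonempty (UnitAddCircle ≃ₜ OnePoint ℝ) := by
  have e₁ : UnitAddCircle ≃ₜ Circle := AddCircle.homeomorphCircle one_ne_zero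
  have e₂ : Circle ≃ₜ Metric.sphere (0 : EuclideanSpace ℝ (Fin 2)) 1 :=
    Complex.orthonormalBasisOneI.repr.toHomeomorph.subtype (p := fun z => z ∈ Metric.sphere 0 1) fun z => by simp
  have e₃ : OnePoint ℝ ≃ₜ Metric.sphere (0 : EuclideanSpace ℝ (Fin 2)) 1 :=
    onePointEquivSphereOfFinrankEq (by simp)
  exact ⟨(e₁.trans e₂).trans e₃.symm⟩

/-- A homeomorphism of the projective line fixing `∞` is monotone or antitone on the line. -/
theorem OnePoint.exists_orderIso_of_homeomorph (g : OnePoint ℝ ≃ₜ OnePoint ℝ) (hg : g ∞ = ∞) :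
    ∃ f : ℝ ≃o ℝ, (∀ x : ℝ, g x = (f x : ℝ)) ∨ ∀ x : ℝ, g x = (-f x : ℝ) := by
  have hne : ∀ x : ℝ, ∃ y : ℝ, (y : OnePoint ℝ) = g x := fun x => by
    rw [← ne_infty_iff_exists, ← hg]
    exact fun h => coe_ne_infty x (g.injective h)
  choose k hk using hne
  have hcont : Continuous k := by
    rw [isOpenEmbedding_coe.isEmbedding.continuous_iff]
    exact (g.continuous.comp continuous_coe).congr fun x => (hk x).symm
  have hinj : Function.Injective k := fun x y hxy => by
    have : g x = g y := by rw [← hk, ← hk, hxy]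
    simpa using this
  have hsurj : Function.Surjective k := fun y => by
    have h : g.symm y ≠ ∞ := fun h => by
      rw [Homeomorph.symm_apply_eq, hg] at h
      exact coe_ne_infty y h
    obtain ⟨x, hx⟩ := ne_infty_iff_exists.1 h
    refine ⟨x, ?_⟩
    rw [← coe_eq_coe, hk, hx, Homeomorph.apply_symm_apply]
  rcases hcont.strictMono_of_inj hinj with h | h
  · exact ⟨h.orderIsoOfSurjective k hsurj, .inl fun x => (hk x).symm⟩
  · refine ⟨StrictMono.orderIsoOfSurjective (fun x => -k x) h.neg (neg_surjective.comp hsurj),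
      .inr fun x => ?_⟩
    rw [← hk, StrictMono.coe_orderIsoOfSurjective, neg_neg]

theorem isBergman_homeomorph_unitAddCircle : IsBergman (UnitAddCircle ≃ₜ UnitAddCircle) := by
  obtain ⟨e⟩ := OnePoint.nonempty_homeomorph_unitAddCircle
  let j : (UnitAddCircle ≃ₜ UnitAddCircle) →* Equiv.Perm (OnePoint ℝ) :=
    { toFun g := ((e.symm.trans g).trans e).toEquiv
      map_one' := by ext x; exact e.apply_symm_apply x
      map_mul' g h := by
        ext x
        change e (g (h (e.symm x))) = e (g (e.symm (e (h (e.symm x)))))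
        rw [e.symm_apply_apply] }
  have hmem : ∀ g : OnePoint ℝ ≃ₜ OnePoint ℝ, g.toEquiv ∈ j.range := fun g => by
    refine ⟨(e.trans g).trans e.symm, ?_⟩
    ext x
    change e (e.symm (g (e (e.symm x)))) = g x
    simp
  refine isBergman_of_injective_perm j (fun g h hgh => ?_)
    (fun f => hmem (Homeomorph.onePointCongr f.toHomeomorph))
    (hmem (OnePoint.continuous_cyclicPerm.homeoOfEquivCompactToT2))
    fun g hg => exists_orderIso_of_homeomorph ((e.symm.trans g).trans e) hg
  ext x
  have : e (g (e.symm (e x))) = e (h (e.symm (e x))) := DFunLike.congr_fun hgh (e x)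
  simpa using this

end Homeomorph

/-! ### Cyclic orders on the projective line and on the circle. -/

/-- The cyclic relation induced by a strict order: `x < y < z` up to a cyclic permutation. -/
def CyclicLT {α : Type*} [LT α] (x y z : α) : Prop :=
  (x < y ∧ y < z) ∨ (y < z ∧ z < x) ∨ (z < x ∧ x < y)

namespace OnePoint

variable {K : Type*}

/-- The projective line, cut open at `∞`. -/
def toWithTop (x : OnePoint K) : WithTop K := x.elim ⊤ WithTop.some

@[simp]
theorem toWithTop_infty : toWithTop (infty : OnePoint K) = ⊤ := rfl

@[simp]
theorem toWithTop_coe (x : K) : toWithTop (x : OnePoint K) = (x : WithTop K) := rfl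

theorem toWithTop_permOfOrderIso_lt_iff [LinearOrder K] (f : K ≃o K) (x y : OnePoint K) :
    toWithTop (permOfOrderIso f x) < toWithTop (permOfOrderIso f y) ↔
      toWithTop x < toWithTop y := by
  induction x <;> induction y <;> simp

variable [Field K] [LinearOrder K] [IsStrictOrderedRing K]

/-- The map cuts the line just after `1` and swaps the blocks: it is increasing on `(-∞, 1]` and on
`(1, ∞]`, and moves the second below the first. Such a cut preserves the cyclic order. -/
theorem toWithTop_cyclicPerm_lt_iff (x y : OnePoint K) :
    toWithTop (cyclicPerm x) < toWithTop (cyclicPerm y) ↔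
      (toWithTop x ≤ 1 ∧ toWithTop y ≤ 1 ∧ toWithTop x < toWithTop y) ∨
      (1 < toWithTop x ∧ 1 < toWithTop y ∧ toWithTop x < toWithTop y) ∨
      (1 < toWithTop x ∧ toWithTop y ≤ 1) := by
  induction x with
  | infty =>
    induction y with
    | infty => simp
    | coe y =>
      by_cases hy : y = 1
      · subst hy
        simp [cyclicPerm_infty, cyclicPerm_one]
      · simp [cyclicPerm_infty, cyclicPerm_coe hy]
        exact ⟨le_of_lt, fun h => lt_of_le_of_ne h hy⟩
  | coe x =>
    by_cases hx : x = 1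
    · subst hx
      simp [cyclicPerm_one]
    · induction y with
      | infty =>
        simp [cyclicPerm_infty, cyclicPerm_coe hx]
      | coe y =>
        by_cases hy : y = 1
        · subst hy
          simp [cyclicPerm_coe hx, cyclicPerm_one]
          grind
        · simp [cyclicPerm_coe hx, cyclicPerm_coe hy]
          rcases lt_or_gt_of_ne hx with h1 | h1 <;> rcases lt_or_gt_of_ne hy with h2 | h2
          · have e1 : 0 < 1 - x := by linarith
            have e2 : 0 < 1 - y := by linarith
            rw [inv_lt_inv₀ e1 e2]
            grind
          · have e1 : 0 < (1 - x)⁻¹ := inv_pos.2 (by linarith)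
            have e2 : (1 - y)⁻¹ < 0 := inv_lt_zero.2 (by linarith)
            grind
          · have e1 : 0 < (1 - y)⁻¹ := inv_pos.2 (by linarith)
            have e2 : (1 - x)⁻¹ < 0 := inv_lt_zero.2 (by linarith)
            grind
          · have e1 : 1 - x < 0 := by linarith
            have e2 : 1 - y < 0 := by linarith
            rw [inv_lt_inv_of_neg e1 e2]
            grind

theorem cyclicLT_cyclicPerm_iff (x y z : OnePoint K) :
    CyclicLT (toWithTop (cyclicPerm x)) (toWithTop (cyclicPerm y)) (toWithTop (cyclicPerm z)) ↔
      CyclicLT (toWithTop x) (toWithTop y) (toWithTop z) := by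
  simp only [CyclicLT, toWithTop_cyclicPerm_lt_iff]
  generalize toWithTop x = a
  generalize toWithTop y = b
  generalize toWithTop z = c
  grind

end OnePoint

namespace CircleOrder

open OnePoint

theorem sbtw_coe_iff {a x y z : ℝ} (hx : x ∈ Set.Ioc a (a + 1)) (hy : y ∈ Set.Ioc a (a + 1))
    (hz : z ∈ Set.Ioc a (a + 1)) :
    sbtw (x : UnitAddCircle) (y : UnitAddCircle) (z : UnitAddCircle) ↔ CyclicLT x y z := by
  -- The circular order on the quotient compares representatives in a period starting at `z`. For
  -- `u` in the window these are `u` or `u + 1`.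
  have hico : ∀ u ∈ Set.Ioc a (a + 1), toIcoMod zero_lt_one z u = if z ≤ u then u else u + 1 := by
    intro u hu
    split_ifs with h
    · exact (toIcoMod_eq_self _).2 ⟨h, by linarith [hu.2, hz.1]⟩
    · rw [← toIcoMod_add_right]
      exact (toIcoMod_eq_self _).2 ⟨by linarith [hu.1, hz.2], by linarith⟩
  have hioc : ∀ u ∈ Set.Ioc a (a + 1), toIocMod zero_lt_one z u = if z < u then u else u + 1 := by
    intro u hu
    split_ifs with h
    · exact (toIocMod_eq_self _).2 ⟨h, by linarith [hu.2, hz.1]⟩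
    · rw [← toIocMod_add_right]
      exact (toIocMod_eq_self _).2 ⟨by linarith [hu.1, hz.2], by linarith⟩
  rw [sbtw_iff_not_btw, QuotientAddGroup.btw_coe_iff, hico y hy, hioc x hx, CyclicLT]
  obtain ⟨hx1, hx2⟩ := hx
  obtain ⟨hy1, hy2⟩ := hy
  split_ifs <;> grind

/-- A countable dense subset of the circle is cyclically ordered like the rational projective
line. -/
theorem exists_equiv_onePoint_rat (C : Set UnitAddCircle) (hC : C.Countable) (hd : Dense C) :
    ∃ e : C ≃ OnePoint ℚ, ∀ x y z : C, CWBetween x y z ↔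
      CyclicLT (toWithTop (e z)) (toWithTop (e y)) (toWithTop (e x)) := by
  classical
  -- The circle is cut at a point of `C`, which becomes `∞`. The window `Ioc` puts it at the right
  -- end `a + 1`, as `toWithTop` puts `∞` on top.
  obtain ⟨c, hc⟩ := hd.nonempty
  obtain ⟨a, rfl⟩ := QuotientAddGroup.mk_surjective c
  let v : C → ℝ := fun x => (AddCircle.equivIoc 1 a x : ℝ)
  have hv : ∀ x, v x ∈ Set.Ioc a (a + 1) := fun x => (AddCircle.equivIoc 1 a x).2
  have hvx : ∀ x, ((v x : ℝ) : UnitAddCircle) = x := fun x =>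
    (AddCircle.equivIoc 1 a).symm_apply_apply (x : UnitAddCircle)
  have hinj : Function.Injective v := fun x y h => Subtype.ext <| by rw [← hvx, h, hvx]
  have hvr : ∀ (x : C) (r : ℝ), r ∈ Set.Ioc a (a + 1) → (r : UnitAddCircle) = x → v x = r := by
    intro x r hr hrx
    have := (AddCircle.equivIoc 1 a).apply_symm_apply ⟨r, hr⟩
    exact congrArg Subtype.val ((congrArg (AddCircle.equivIoc 1 a) hrx.symm).trans this)
  let p : C := ⟨_, hc⟩
  have hp : v p = a + 1 := hvr p (a + 1) ⟨by linarith, le_rfl⟩ (by simp [p])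
  have hlt : ∀ x ≠ p, v x < a + 1 := fun x hx =>
    (hv x).2.lt_of_ne fun h => hx (hinj (h.trans hp.symm))
  let D := {x : C // x ≠ p}
  have hdense : ∀ r s : ℝ, a ≤ r → r < s → s ≤ a + 1 → ∃ d : D, r < v d ∧ v d < s := by
    intro r s har hrs hs
    have hopen : IsOpen ((fun x : ℝ => (x : UnitAddCircle)) '' Set.Ioo r s) :=
      QuotientAddGroup.isOpenMap_coe _ isOpen_Ioo
    obtain ⟨_, ⟨q, hq, rfl⟩, hqC⟩ := hd.inter_open_nonempty _ hopen ((Set.nonempty_Ioo.2 hrs).image _)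
    have hvq : v ⟨_, hqC⟩ = q := hvr _ q ⟨har.trans_lt hq.1, hq.2.le.trans hs⟩ rfl
    refine ⟨⟨⟨_, hqC⟩, fun h => ?_⟩, ?_, ?_⟩
    · rw [h, hp] at hvq
      linarith [hq.2]
    · rw [hvq]; exact hq.1
    · rw [hvq]; exact hq.2
  let _ : LinearOrder D := LinearOrder.lift' (fun x : D => v x) (hinj.comp Subtype.val_injective)
  have hDlt : ∀ x y : D, x < y ↔ v x < v y := fun _ _ => Iff.rfl
  have : Countable C := hC.to_subtype
  have : Countable D := Subtype.countable
  have : DenselyOrdered D := ⟨fun x y h => by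
    obtain ⟨d, h1, h2⟩ := hdense (v x) (v y) (hv x).1.le h (hv y).2
    exact ⟨d, h1, h2⟩⟩
  have : NoMinOrder D := ⟨fun x => by
    obtain ⟨d, h1, h2⟩ := hdense a (v x) le_rfl (hv x).1 (hv x).2
    exact ⟨d, h2⟩⟩
  have : NoMaxOrder D := ⟨fun x => by
    obtain ⟨d, h1, h2⟩ := hdense (v x) (a + 1) (hv x).1.le (hlt x x.2) le_rfl
    exact ⟨d, h1⟩⟩
  have : Nonempty D := by
    obtain ⟨d, -⟩ := hdense a (a + 1) le_rfl (by linarith) le_rfl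
    exact ⟨d⟩
  obtain ⟨i⟩ := Order.iso_of_countable_dense D ℚ
  let e : C ≃ OnePoint ℚ := (Equiv.optionSubtypeNe p).symm.trans (Equiv.optionCongr i.toEquiv)
  have hep : e p = infty := by
    change Option.map i ((Equiv.optionSubtypeNe p).symm p) = none
    simp
  have hex : ∀ (x : C) (hx : x ≠ p), e x = (i ⟨x, hx⟩ : ℚ) := fun x hx => by
    change Option.map i ((Equiv.optionSubtypeNe p).symm x) = Option.some _
    rw [Equiv.optionSubtypeNe_symm_of_ne hx, Option.map_some]
  have he : ∀ x y, toWithTop (e x) < toWithTop (e y) ↔ v x < v y := fun x y => by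
    by_cases hx : x = p
    · rw [hx, hep, hp]
      simpa using (hv y).2
    · by_cases hy : y = p
      · rw [hy, hep, hp, hex x hx]
        simpa using hlt x hx
      · rw [hex x hx, hex y hy, toWithTop_coe, toWithTop_coe, WithTop.coe_lt_coe, i.lt_iff_lt, hDlt]
  refine ⟨e, fun x y z => ?_⟩
  rw [CWBetween, ← hvx x, ← hvx y, ← hvx z, sbtw_coe_iff (hv z) (hv y) (hv x)]
  simp only [CyclicLT, he]

theorem isBergman_aut (C : Set UnitAddCircle) (hC : C.Countable) (hd : Dense C) :
    IsBergman (aut C) := by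
  obtain ⟨e, he⟩ := exists_equiv_onePoint_rat C hC hd
  let j : aut C →* Equiv.Perm (OnePoint ℚ) := e.permCongrHom.toMonoidHom.comp (aut C).subtype
  have hj : ∀ (g : aut C) (x), j g x = e ((g : Equiv.Perm C) (e.symm x)) := fun _ _ => rfl
  have hmem : ∀ g : Equiv.Perm (OnePoint ℚ),
      (∀ x y z, CyclicLT (toWithTop (g x)) (toWithTop (g y)) (toWithTop (g z)) ↔
        CyclicLT (toWithTop x) (toWithTop y) (toWithTop z)) → g ∈ j.range := fun g hg => by
    have hg' : e.permCongrHom.symm g ∈ aut C := fun x y z => by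
      have h : ∀ x, e (e.permCongrHom.symm g x) = g (e x) := fun x => e.apply_symm_apply _
      rw [he, he, h, h, h, hg]
    exact ⟨⟨_, hg'⟩, e.permCongrHom.apply_symm_apply g⟩
  refine isBergman_of_injective_perm j
    (e.permCongrHom.injective.comp (aut C).subtype_injective)
    (fun f => hmem _ fun x y z => by simp only [CyclicLT, toWithTop_permOfOrderIso_lt_iff])
    (hmem _ cyclicLT_cyclicPerm_iff) fun g hg => ?_
  have hpres : ∀ x y z, CyclicLT (toWithTop (j g x)) (toWithTop (j g y)) (toWithTop (j g z)) ↔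
      CyclicLT (toWithTop x) (toWithTop y) (toWithTop z) := fun x y z => by
    have := g.2 (e.symm z) (e.symm y) (e.symm x)
    rw [he, he] at this
    simpa [hj] using this
  have hne : ∀ x : ℚ, ∃ y : ℚ, (y : OnePoint ℚ) = j g x := fun x => by
    rw [← ne_infty_iff_exists, ← hg]
    exact fun h => coe_ne_infty x ((j g).injective h)
  choose k hk using hne
  -- With `∞` on top as third argument, the cyclic relation of finite points `x`, `y` reduces to `x
  -- < y`, so the antitone case does not occur here.
  have hmono : StrictMono k := fun x y hxy => by
    have := (hpres x y infty).2 (.inl ⟨by simpa using hxy, by simp⟩)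
    rw [hg, ← hk, ← hk] at this
    simpa [CyclicLT] using this
  have hsurj : Function.Surjective k := fun y => by
    have h : (j g).symm y ≠ infty := fun h => by
      rw [Equiv.symm_apply_eq, hg] at h
      exact coe_ne_infty y h
    obtain ⟨x, hx⟩ := ne_infty_iff_exists.1 h
    refine ⟨x, ?_⟩
    rw [← coe_eq_coe, hk, hx, Equiv.apply_symm_apply]
  exact ⟨hmono.orderIsoOfSurjective k hsurj, .inl fun x => (hk x).symm⟩

end CircleOrder

theorem mainTheorem12 :
    (∀ C : Set UnitAddCircle, C.Countable → Dense C → IsBergman (CircleOrder.aut C)) ∧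
      IsBergman (UnitAddCircle ≃ₜ UnitAddCircle) :=
  ⟨CircleOrder.isBergman_aut, isBergman_homeomorph_unitAddCircle⟩
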